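/- Let $p\ge 1$ and $m,n$ be integers with $m+p\le n$. Let $\mathbf{x}:\mathbb{R}^p\to\mathbb{C}^n$ have partial derivatives at $\boldsymbol\theta\in\mathbb{R}^p$, let $\mathbf{G}=[\partial\mathbf{x}/\partial\theta_1,\dots,\partial\mathbf{x}/\partial\theta_p]\in\mathbb{C}^{n\times p}$ be the matrix of these derivatives at $\boldsymbol\theta$, let $\sigma>0$, and suppose that the Fisher information matrix $\mathbf{J}=\frac{1}{\sigma^2}\mathbf{G}^H\mathbf{G}$ (of the model $\mathbf{y}\sim\mathcal{CN}(\mathbf{x}(\boldsymbol\theta),\sigma^2\mathbf{I}_n)$) is invertible. Let $\boldsymbol\Phi$ be a random $m\times n$ complex matrix that almost surely has full row rank $m$ and whose distribution is right-unitarily invariant, i.e. $\boldsymbol\Phi\mathbf{U}$ has the same distribution as $\boldsymbol\Phi$ for every unitary $\mathbf{U}\in\mathbb{C}^{n\times n}$ (for example, $\boldsymbol\Phi$ with i.i.d. $\mathcal{CN}(0,1)$ entries). Let $$\hat{\mathbf{J}}=\frac{1}{\sigma^2}\hat{\mathbf{G}}^H\hat{\mathbf{G}},\qquad \hat{\mathbf{G}}=\mathbf{P}_{\boldsymbol\Phi^H}\mathbf{G},\qquad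 \mathbf{P}_{\boldsymbol\Phi^H}=\boldsymbol\Phi^H(\boldsymbol\Phi\boldsymbol\Phi^H)^{-1}\boldsymbol\Phi,$$ be the Fisher information matrix of the compressed data $\boldsymbol\Phi\mathbf{y}$. Then for every $i\in\{1,\dots,p\}$: * if $m>p$, then $\hat{\mathbf{J}}$ is almost surely invertible, $(\hat{\mathbf{J}}^{-1})_{ii}$ is integrable, and $$E[(\hat{\mathbf{J}}^{-1})_{ii}]=\frac{n-p}{m-p}\,(\mathbf{J}^{-1})_{ii};$$ * if $m>p+1$, then $(\hat{\mathbf{J}}^{-1})_{ii}$ is square integrable, and $$\mathrm{var}[(\hat{\mathbf{J}}^{-1})_{ii}]=\frac{(n-m)(n-p)}{(m-p-1)(m-p)^2}\,\big((\mathbf{J}^{-1})_{ii}\big)^2.$$ -/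

import Mathlib

open MeasureTheory ProbabilityTheory
open scoped Matrix

noncomputable section

namespace CompressedCRB

/-- The matrix `G = [g₁, …, g_p]` whose `i`-th column `g_i = ∂x/∂θ_i` is the partial derivative
at `θ` of the mean vector `x` with respect to the `i`-th (real) parameter. -/
def sensitivityMatrix {n p : ℕ} (x : (Fin p → ℝ) → (Fin n → ℂ)) (θ : Fin p → ℝ) :
    Matrix (Fin n) (Fin p) ℂ :=
  Matrix.of fun k i => lineDeriv ℝ x θ (Pi.single i 1) k

/-- The Fisher information matrix `J = (1/σ²) Gᴴ G` for the mean of `CN(x(θ), σ² I)`, in terms of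
the sensitivity matrix `G` of the mean. -/
def fisherInformation {n p : ℕ} (σ : ℝ) (G : Matrix (Fin n) (Fin p) ℂ) :
    Matrix (Fin p) (Fin p) ℂ :=
  (1 / (σ : ℂ) ^ 2) • (Gᴴ * G)

/-- `P = Φᴴ (Φ Φᴴ)⁻¹ Φ`, the orthogonal projection onto the row span of a matrix `Φ` of full
row rank. -/
def rowProjection {m n : ℕ} (Φ : Matrix (Fin m) (Fin n) ℂ) : Matrix (Fin n) (Fin n) ℂ :=
  Φᴴ * (Φ * Φᴴ)⁻¹ * Φ

/-- The Fisher information matrix `Ĵ = (1/σ²) Ĝᴴ Ĝ`, with `Ĝ = P G`, after compression by `Φ`. -/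
def compressedFisherInformation {m n p : ℕ} (σ : ℝ) (Φ : Matrix (Fin m) (Fin n) ℂ)
    (G : Matrix (Fin n) (Fin p) ℂ) : Matrix (Fin p) (Fin p) ℂ :=
  fisherInformation σ (rowProjection Φ * G)

/-- The Cramér-Rao bound on the `i`-th parameter: the `i`-th diagonal entry of `J⁻¹`, as a real
number. For a Fisher information matrix that entry is real, see `coe_crb`. -/
def crb {p : ℕ} (J : Matrix (Fin p) (Fin p) ℂ) (i : Fin p) : ℝ :=
  (J⁻¹ i i).re

theorem isHermitian_fisherInformation {n p : ℕ} (σ : ℝ) (G : Matrix (Fin n) (Fin p) ℂ) :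
    (fisherInformation σ G).IsHermitian := by
  unfold fisherInformation Matrix.IsHermitian
  rw [Matrix.conjTranspose_smul, Matrix.conjTranspose_mul, Matrix.conjTranspose_conjTranspose]
  simp

theorem coe_crb {n p : ℕ} (σ : ℝ) (G : Matrix (Fin n) (Fin p) ℂ) (i : Fin p) :
    ((crb (fisherInformation σ G) i : ℝ) : ℂ) = (fisherInformation σ G)⁻¹ i i :=
  (isHermitian_fisherInformation σ G).inv.coe_re_apply_self i

/-- The random matrix `Φ` on `(Ω, μ)` has a right-unitarily invariant distribution: `Φ U` has the
same law as `Φ` for every unitary `n × n` matrix `U`. A matrix is regarded as the family of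
its entries, with the product (Borel) σ-algebra. -/
structure IsRightUnitarilyInvariant {Ω : Type*} [MeasurableSpace Ω] (μ : Measure Ω) {m n : ℕ}
    (Φ : Ω → Matrix (Fin m) (Fin n) ℂ) : Prop where
  aemeasurable : AEMeasurable (fun ω (k : Fin m) (l : Fin n) => Φ ω k l) μ
  map_mul_eq : ∀ U ∈ Matrix.unitaryGroup (Fin n) ℂ,
    μ.map (fun ω (k : Fin m) (l : Fin n) => (Φ ω * U) k l) =
      μ.map (fun ω (k : Fin m) (l : Fin n) => Φ ω k l)

end CompressedCRB

end

/-!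
Let `V` be the orthogonal complement of the columns of `G` other than the `i`-th one, and let `y` be
the component of the `i`-th column in `V`. By the Gram matrix formula, `(J⁻¹)ᵢᵢ = σ² / ‖y‖²`. If `K`
is the row space of `Φ`, then compressing by `Φ` replaces `y` by its projection onto `K ∩ V`, which
is a unitarily invariant random subspace of `V` of dimension `m + 1 - p`.

For a unitarily invariant random subspace `L` the moment `E ‖P_L y‖ ^ (-r)` depends on `y` only
through `‖y‖`. Averaging over a Gaussian `y` and exchanging the integrals therefore gives this
moment as a ratio of negative moments of the norms of Gaussian vectors in `L` and in `V`, that is,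
of Gamma functions. Since the moment is finite for small `r`, also `P_L y ≠ 0` almost surely when
`y ≠ 0`. Adding one vector at a time, it follows that the complement of `K` almost surely meets the
span of the columns of `G` only in `0`, so that the compressed columns remain independent.
-/

namespace CompressedCRB

open Module Set
open scoped ENNReal InnerProductSpace

/-- The integral of `‖x‖ ^ (-r)` against the probability measure with density proportional to
`exp (-‖x‖ ^ 2)` on a real inner product space of dimension `d`, when `r < d`. -/
noncomputable def gaussianNegMoment (d r : ℝ) : ℝ :=
  Real.Gamma ((d - r) / 2) / Real.Gamma (d / 2)

theorem gaussianNegMoment_pos {d r : ℝ} (hr₀ : 0 ≤ r) (hr : r < d) : 0 < gaussianNegMoment d r :=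
  div_pos (Real.Gamma_pos_of_pos (by linarith)) (Real.Gamma_pos_of_pos (by linarith))

theorem gaussianNegMoment_two {d : ℝ} (hd : 2 < d) : gaussianNegMoment d 2 = (d / 2 - 1)⁻¹ := by
  have hΓ : Real.Gamma (d / 2) = (d / 2 - 1) * Real.Gamma (d / 2 - 1) := by
    rw [← Real.Gamma_add_one (by linarith), sub_add_cancel]
  rw [gaussianNegMoment, sub_div, div_self two_ne_zero, hΓ,
    div_mul_cancel_right₀ (Real.Gamma_pos_of_pos (by linarith)).ne']

theorem gaussianNegMoment_four {d : ℝ} (hd : 4 < d) :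
    gaussianNegMoment d 4 = ((d / 2 - 1) * (d / 2 - 2))⁻¹ := by
  have hΓ : Real.Gamma (d / 2) = (d / 2 - 1) * (d / 2 - 2) * Real.Gamma (d / 2 - 2) := by
    have h₁ := Real.Gamma_add_one (s := d / 2 - 1) (by linarith)
    have h₂ := Real.Gamma_add_one (s := d / 2 - 2) (by linarith)
    rw [sub_add_cancel] at h₁
    rw [show d / 2 - 2 + 1 = d / 2 - 1 by ring] at h₂
    rw [h₁, h₂, mul_assoc]
  have hhalf : (d - 4) / 2 = d / 2 - 2 := by ring
  rw [gaussianNegMoment, hhalf, hΓ,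
    div_mul_cancel_right₀ (Real.Gamma_pos_of_pos (by linarith)).ne']

section GaussianWeight

variable {V : Type*} [NormedAddCommGroup V] [InnerProductSpace ℝ V] [FiniteDimensional ℝ V]
  [MeasurableSpace V] [BorelSpace V]

variable (V) in
/-- The unnormalised Gaussian measure with density `exp (-‖x‖ ^ 2)`. -/
noncomputable def gaussianWeight : Measure V :=
  volume.withDensity fun x => ENNReal.ofReal (Real.exp (-‖x‖ ^ 2))

theorem lintegral_gaussianWeight (f : V → ℝ≥0∞) (hf : Measurable f) :
    ∫⁻ x, f x ∂gaussianWeight V = ∫⁻ x, ENNReal.ofReal (Real.exp (-‖x‖ ^ 2)) * f x := by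
  rw [gaussianWeight, lintegral_withDensity_eq_lintegral_mul _ (by fun_prop) hf]
  rfl

theorem integrable_and_integral_norm_rpow_mul_exp_neg_norm_sq [Nontrivial V] {r : ℝ}
    (hr : r < finrank ℝ V) :
    Integrable (fun x : V => ‖x‖ ^ (-r) * Real.exp (-‖x‖ ^ 2)) ∧
      ∫ x : V, ‖x‖ ^ (-r) * Real.exp (-‖x‖ ^ 2) =
        finrank ℝ V * volume.real (Metric.ball (0 : V) 1) / 2 *
          Real.Gamma ((finrank ℝ V - r) / 2) := by
  have hradial : EqOn
      (fun y : ℝ => y ^ (finrank ℝ V - 1) • (y ^ (-r) * Real.exp (-y ^ 2)))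
      (fun y => y ^ ((finrank ℝ V : ℝ) - 1 - r) * Real.exp (-y ^ (2 : ℝ))) (Ioi 0) := by
    intro y (hy : 0 < y)
    simp only [smul_eq_mul, Real.rpow_two]
    rw [← mul_assoc, ← Real.rpow_natCast, ← Real.rpow_add hy,
      Nat.cast_sub finrank_pos, Nat.cast_one, sub_eq_add_neg _ r]
  constructor
  · rw [integrable_fun_norm_addHaar volume (f := fun y => y ^ (-r) * Real.exp (-y ^ 2)),
      integrableOn_congr_fun hradial measurableSet_Ioi]
    exact integrableOn_rpow_mul_exp_neg_rpow (by linarith) two_pos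
  · rw [integral_fun_norm_addHaar volume (fun y => y ^ (-r) * Real.exp (-y ^ 2)),
      setIntegral_congr_fun measurableSet_Ioi hradial,
      integral_rpow_mul_exp_neg_rpow two_pos (by linarith)]
    simp only [nsmul_eq_mul, smul_eq_mul]
    ring_nf

theorem lintegral_enorm_rpow_gaussianWeight_eq [Nontrivial V] {r : ℝ} (hr : r < finrank ℝ V) :
    ∫⁻ x, ‖x‖ₑ ^ (-r) ∂gaussianWeight V =
      ENNReal.ofReal (finrank ℝ V * volume.real (Metric.ball (0 : V) 1) / 2 *
        Real.Gamma ((finrank ℝ V - r) / 2)) := by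
  obtain ⟨hint, heq⟩ := integrable_and_integral_norm_rpow_mul_exp_neg_norm_sq hr
  rw [lintegral_gaussianWeight _ (by fun_prop), ← heq,
    ofReal_integral_eq_lintegral_ofReal hint (ae_of_all _ fun x => by positivity)]
  refine lintegral_congr_ae ?_
  filter_upwards [compl_mem_ae_iff.2 (measure_singleton (0 : V))] with x hx
  rw [mul_comm (‖x‖ ^ (-r)), ENNReal.ofReal_mul (Real.exp_pos _).le,
    ← ENNReal.ofReal_rpow_of_pos (norm_pos_iff.2 hx), ofReal_norm]

variable (V) in
theorem gaussianWeight_univ :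
    gaussianWeight V univ = ENNReal.ofReal (Real.pi ^ (finrank ℝ V / 2 : ℝ)) := by
  have heq := GaussianFourier.integral_rexp_neg_mul_sq_norm (V := V) one_pos
  have hint := Integrable.of_integral_ne_zero
    (heq.trans_ne (by positivity))
  rw [div_one] at heq
  rw [← heq, ofReal_integral_eq_lintegral_ofReal hint (ae_of_all _ fun x => by positivity),
    gaussianWeight, withDensity_apply _ MeasurableSet.univ, Measure.restrict_univ]
  simp only [neg_mul, one_mul]

instance : IsFiniteMeasure (gaussianWeight V) :=
  ⟨gaussianWeight_univ V ▸ ENNReal.ofReal_lt_top⟩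

instance : NeZero (gaussianWeight V) :=
  ⟨fun h => (ENNReal.ofReal_pos.2 (Real.rpow_pos_of_pos Real.pi_pos _)).ne'
    ((gaussianWeight_univ V).symm.trans (by rw [h, Measure.coe_zero, Pi.zero_apply]))⟩

theorem lintegral_enorm_rpow_gaussianWeight [Nontrivial V] {r : ℝ} (hr : r < finrank ℝ V) :
    ∫⁻ x, ‖x‖ₑ ^ (-r) ∂gaussianWeight V =
      ENNReal.ofReal (gaussianNegMoment (finrank ℝ V) r) * gaussianWeight V univ := by
  have hpos : (0 : ℝ) < finrank ℝ V := by exact_mod_cast finrank_pos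
  have hmass := lintegral_enorm_rpow_gaussianWeight_eq (V := V) hpos
  simp only [neg_zero, ENNReal.rpow_zero, lintegral_const, one_mul, sub_zero] at hmass
  rw [gaussianNegMoment, hmass, ← ENNReal.ofReal_mul (by positivity),
    lintegral_enorm_rpow_gaussianWeight_eq hr]
  congr 1
  field_simp

theorem map_orthogonalProjectionOnto_gaussianWeight (K : Submodule ℝ V) :
    (gaussianWeight V).map K.orthogonalProjectionOnto =
      gaussianWeight Kᗮ univ • gaussianWeight K := by
  have hprod : (gaussianWeight V).map (K.measurableEquivProd (0 : V)) =
      (gaussianWeight K).prod (gaussianWeight Kᗮ) := by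
    have hvol : MeasurePreserving (K.measurableEquivProd (0 : V)) := by
      simpa only [InnerProductSpace.euclideanHausdorffMeasure_eq_volume] using
        K.measurePreserving_measurableEquivProd (0 : V)
    ext s hs
    rw [Measure.map_apply (MeasurableEquiv.measurable _) hs, gaussianWeight,
      withDensity_apply _ (hs.preimage (MeasurableEquiv.measurable _)), gaussianWeight,
      gaussianWeight, prod_withDensity (by fun_prop) (by fun_prop), withDensity_apply _ hs,
      ← Measure.volume_eq_prod,
      ← hvol.setLIntegral_comp_preimage hs (by fun_prop)]
    refine lintegral_congr fun x => ?_
    rw [← ENNReal.ofReal_mul (Real.exp_pos _).le, ← Real.exp_add,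
      K.norm_sq_eq_add_norm_sq_projection x, Submodule.measurableEquivProd_apply]
    simp only [vsub_eq_sub, sub_zero]
    ring_nf
  have hfst : K.orthogonalProjectionOnto = Prod.fst ∘ K.measurableEquivProd (0 : V) := by
    ext1 x; simp
  rw [hfst, ← Measure.map_map measurable_fst (MeasurableEquiv.measurable _), hprod,
    Measure.map_fst_prod]

theorem lintegral_enorm_starProjection_rpow_gaussianWeight (K : Submodule ℝ V) {r : ℝ}
    (hr₀ : 0 ≤ r) (hr : r < finrank ℝ K) :
    ∫⁻ x, ‖K.starProjection x‖ₑ ^ (-r) ∂gaussianWeight V =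
      ENNReal.ofReal (gaussianNegMoment (finrank ℝ K) r) * gaussianWeight V univ := by
  have hK : Nontrivial K := nontrivial_of_finrank_pos (by exact_mod_cast hr₀.trans_lt hr)
  have hmap := map_orthogonalProjectionOnto_gaussianWeight K
  have hmass : gaussianWeight V univ = gaussianWeight Kᗮ univ * gaussianWeight K univ := by
    rw [← smul_eq_mul, ← Measure.smul_apply, ← hmap,
      Measure.map_apply (by fun_prop) MeasurableSet.univ, preimage_univ]
  calc ∫⁻ x, ‖K.starProjection x‖ₑ ^ (-r) ∂gaussianWeight V
      = ∫⁻ x, ‖x‖ₑ ^ (-r) ∂(gaussianWeight V).map K.orthogonalProjectionOnto := by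
        rw [lintegral_map (by fun_prop) (by fun_prop)]
        rfl
    _ = _ := by
        rw [hmap, lintegral_smul_measure, lintegral_enorm_rpow_gaussianWeight hr, hmass,
          smul_eq_mul, mul_left_comm]

end GaussianWeight

theorem exists_isProbabilityMeasure_lintegral_enorm_starProjection_rpow (𝕜 E : Type*) [RCLike 𝕜]
    [NormedAddCommGroup E] [InnerProductSpace 𝕜 E] [FiniteDimensional 𝕜 E] [MeasurableSpace E]
    [BorelSpace E] :
    ∃ γ : Measure E, IsProbabilityMeasure γ ∧ ∀ (K : Submodule 𝕜 E) (r : ℝ), 0 ≤ r →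
      r < finrank ℝ 𝕜 * finrank 𝕜 K →
      ∫⁻ x, ‖K.starProjection x‖ₑ ^ (-r) ∂γ =
        ENNReal.ofReal (gaussianNegMoment (finrank ℝ 𝕜 * finrank 𝕜 K) r) := by
  let : InnerProductSpace ℝ E := InnerProductSpace.rclikeToReal 𝕜 E
  have : IsScalarTower ℝ 𝕜 E := RestrictScalars.isScalarTower ℝ 𝕜 E
  have : FiniteDimensional ℝ E := FiniteDimensional.trans ℝ 𝕜 E
  have hne : gaussianWeight E univ ≠ 0 := NeZero.ne _
  refine ⟨(gaussianWeight E univ)⁻¹ • gaussianWeight E, inferInstance, fun K r hr₀ hr => ?_⟩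
  have hproj : ∀ x, (K.restrictScalars ℝ).starProjection x = K.starProjection x := fun x => by
    refine Submodule.eq_starProjection_of_mem_of_inner_eq_zero (K.starProjection_apply_mem x)
      fun w hw => ?_
    rw [real_inner_eq_re_inner 𝕜, K.starProjection_inner_eq_zero x w hw, map_zero]
  have hdim : (finrank ℝ (K.restrictScalars ℝ) : ℝ) = finrank ℝ 𝕜 * finrank 𝕜 K := by
    rw [← Nat.cast_mul, finrank_mul_finrank ℝ 𝕜 K]
    rfl
  have h := lintegral_enorm_starProjection_rpow_gaussianWeight (K.restrictScalars ℝ) hr₀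
    (hr.trans_eq hdim.symm)
  simp only [hproj, hdim] at h
  rw [lintegral_smul_measure, h, smul_eq_mul, mul_left_comm,
    ENNReal.inv_mul_cancel hne (measure_ne_top _ _), mul_one]

theorem measurable_of_forall_apply {α 𝕜 E F : Type*} [MeasurableSpace α]
    [NontriviallyNormedField 𝕜] [CompleteSpace 𝕜] [NormedAddCommGroup E] [NormedSpace 𝕜 E]
    [FiniteDimensional 𝕜 E] [NormedAddCommGroup F] [NormedSpace 𝕜 F] [SecondCountableTopology F]
    [MeasurableSpace F] [BorelSpace F] {f : α → E →L[𝕜] F}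
    (hf : ∀ x, Measurable fun a => f a x) : Measurable f := by
  let b := finBasis 𝕜 E
  have hcont : Continuous fun v : Fin (finrank 𝕜 E) → F =>
      LinearMap.toContinuousLinearMap (b.constr 𝕜 v) := by
    refine continuous_clm_apply.2 fun x => ?_
    simp only [LinearMap.coe_toContinuousLinearMap', Basis.constr_apply_fintype]
    fun_prop
  have hf_eq : f = fun a => LinearMap.toContinuousLinearMap (b.constr 𝕜 fun i => f a (b i)) := by
    ext1 a
    exact ContinuousLinearMap.coe_injective (b.ext fun i => by simp)
  rw [hf_eq]
  exact hcont.measurable.comp (measurable_pi_lambda _ fun i => hf (b i))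

section KernelProjection

variable {𝕜 E F : Type*} [RCLike 𝕜] [NormedAddCommGroup E] [InnerProductSpace 𝕜 E]
  [NormedAddCommGroup F] [InnerProductSpace 𝕜 F]

open ContinuousLinearMap Filter

theorem norm_one_sub_smul_adjoint_comp_self_le [CompleteSpace E] [CompleteSpace F]
    (B : E →L[𝕜] F) {c : ℝ} (hc₀ : 0 ≤ c) (hc : c * ‖B‖ ^ 2 ≤ 2) :
    ‖1 - (c : 𝕜) • (B.adjoint ∘L B)‖ ≤ 1 := by
  refine opNorm_le_bound _ zero_le_one fun x => ?_
  have hinner : RCLike.re ⟪x, (c : 𝕜) • B.adjoint (B x)⟫_𝕜 = c * ‖B x‖ ^ 2 := by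
    rw [inner_smul_right, adjoint_inner_right, inner_self_eq_norm_sq_to_K]
    norm_cast
  have hnorm : ‖B.adjoint (B x)‖ ^ 2 ≤ ‖B‖ ^ 2 * ‖B x‖ ^ 2 := by
    rw [← mul_pow, ← LinearIsometryEquiv.norm_map adjoint B]
    exact pow_le_pow_left₀ (norm_nonneg _) (le_opNorm _ _) 2
  have hsq : ‖x - (c : 𝕜) • B.adjoint (B x)‖ ^ 2 ≤ ‖x‖ ^ 2 := by
    rw [norm_sub_sq (𝕜 := 𝕜), hinner, norm_smul, mul_pow, RCLike.norm_ofReal, sq_abs]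
    nlinarith [mul_le_mul_of_nonneg_left hnorm (sq_nonneg c),
      mul_le_mul_of_nonneg_left hc (mul_nonneg hc₀ (sq_nonneg ‖B x‖))]
  rw [one_mul]
  exact le_of_sq_le_sq hsq (norm_nonneg x)

theorem eqLocus_one_sub_smul_adjoint_comp_self [CompleteSpace E] [CompleteSpace F]
    (B : E →L[𝕜] F) {c : 𝕜} (hc : c ≠ 0) :
    (1 - c • (B.adjoint ∘L B)).eqLocus (1 : E →L[𝕜] E) = B.ker := by
  rw [← ker_adjoint_comp_self]
  ext x
  simp [LinearMap.mem_eqLocus, hc]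

-- By the mean ergodic theorem for the contraction `1 - c • (B.adjoint ∘L B)`, whose fixed points
-- form `B.ker`, the projection onto `B.ker` is a pointwise limit of functions continuous in `B`.
theorem measurable_starProjection_ker [FiniteDimensional 𝕜 E] [FiniteDimensional 𝕜 F] :
    Measurable fun B : E →L[𝕜] F => B.ker.starProjection := by
  borelize E
  have := FiniteDimensional.complete 𝕜 E
  have := FiniteDimensional.complete 𝕜 F
  have := FiniteDimensional.proper_rclike 𝕜 E
  refine measurable_of_forall_apply fun x => ?_
  let c : (E →L[𝕜] F) → ℝ := fun B => (1 + ‖B‖ ^ 2)⁻¹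
  have hc : ∀ B, 0 < c B := fun B => by positivity
  let f : (E →L[𝕜] F) → E →L[𝕜] E := fun B => 1 - (c B : 𝕜) • (B.adjoint ∘L B)
  have hf : Continuous f := by
    have hcc : Continuous c := Continuous.inv₀ (by fun_prop) fun B => by positivity
    fun_prop
  refine measurable_of_tendsto_metrizable (f := fun N B => birkhoffAverage 𝕜 (f B) id N x)
    (fun N => ?_) (tendsto_pi_nhds.2 fun B => ?_)
  · have hiter : ∀ (B : E →L[𝕜] F) k, (f B)^[k] x = (f B ^ k) x := fun B k => by
      rw [FunLike.coe_pow_eq_iterate]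
    simp only [birkhoffAverage, birkhoffSum, hiter, id_eq]
    exact Continuous.measurable (by fun_prop)
  · have hcB : c B * ‖B‖ ^ 2 ≤ 2 := by
      rw [inv_mul_le_iff₀ (by positivity)]
      nlinarith [sq_nonneg ‖B‖]
    have hlim := (f B).tendsto_birkhoffAverage_orthogonalProjection
      (norm_one_sub_smul_adjoint_comp_self_le B (hc B).le hcB) x
    have hker : (f B).eqLocus (1 : E →L[𝕜] E) = B.ker :=
      eqLocus_one_sub_smul_adjoint_comp_self B (RCLike.ofReal_ne_zero.2 (hc B).ne')
    simpa only [← Submodule.starProjection_apply, hker] using hlim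

end KernelProjection

section Geometry

variable {𝕜 E : Type*} [RCLike 𝕜] [NormedAddCommGroup E] [InnerProductSpace 𝕜 E]
  [FiniteDimensional 𝕜 E]

theorem exists_linearIsometryEquiv_extend {S : Submodule 𝕜 E} (L : S →ₗᵢ[𝕜] E) :
    ∃ U : E ≃ₗᵢ[𝕜] E, ∀ x : S, U x = L x :=
  ⟨L.extend.toLinearIsometryEquiv rfl, L.extend_apply⟩

theorem exists_linearIsometryEquiv_apply_eq {x y : E} (h : ‖x‖ = ‖y‖) :
    ∃ U : E ≃ₗᵢ[𝕜] E, U x = y := by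
  rcases eq_or_ne x 0 with rfl | hx
  · exact ⟨.refl 𝕜 E, by simpa [eq_comm] using h⟩
  let coord := LinearEquiv.coord 𝕜 E x hx
  have hcoord : ∀ z : 𝕜 ∙ x, coord z • x = z := LinearEquiv.coord_apply_smul 𝕜 E x hx
  let L : (𝕜 ∙ x) →ₗᵢ[𝕜] E :=
    { toLinearMap := (LinearMap.toSpanSingleton 𝕜 E y).comp coord.toLinearMap
      norm_map' := fun z => by
        change ‖coord z • y‖ = ‖(z : E)‖
        rw [← hcoord z, norm_smul, norm_smul, h] }
  obtain ⟨U, hU⟩ := exists_linearIsometryEquiv_extend L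
  refine ⟨U, (hU ⟨x, Submodule.mem_span_singleton_self x⟩).trans ?_⟩
  simp [L, coord, LinearEquiv.coord_self]

theorem starProjection_comap_subtype (K V : Submodule 𝕜 E) :
    (K.comap V.subtype).starProjection =
      ((1 - K.starProjection) ∘L V.subtypeL).ker.starProjection := by
  congr 1
  ext x
  simp [sub_eq_zero, eq_comm (a := (x : E)), Submodule.starProjection_eq_self_iff]

theorem finrank_comap_subtype_orthogonal_add_finrank {K W : Submodule 𝕜 E} (h : Disjoint W Kᗮ) :
    finrank 𝕜 (K.comap Wᗮ.subtype) + finrank 𝕜 W = finrank 𝕜 K := by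
  have hsup : Wᗮ ⊓ K = (W ⊔ Kᗮ)ᗮ := by
    rw [← Submodule.inf_orthogonal, Submodule.orthogonal_orthogonal]
  have hdim := Submodule.finrank_sup_add_finrank_inf_eq W Kᗮ
  rw [h.eq_bot, finrank_bot] at hdim
  have h₁ := (W ⊔ Kᗮ).finrank_add_finrank_orthogonal
  have h₂ := K.finrank_add_finrank_orthogonal
  rw [← Submodule.finrank_map_subtype_eq, Submodule.map_comap_subtype, hsup]
  omega

theorem disjoint_span_singleton_sup_orthogonal {K W : Submodule 𝕜 E} {x : Wᗮ}
    (hW : Disjoint W Kᗮ) (hx : (K.comap Wᗮ.subtype).starProjection x ≠ 0) :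
    Disjoint (𝕜 ∙ (x : E) ⊔ W) Kᗮ := by
  rw [Submodule.disjoint_def] at hW ⊢
  intro z hz hzK
  obtain ⟨_, hc, w, hw, rfl⟩ := Submodule.mem_sup.1 hz
  obtain ⟨c, rfl⟩ := Submodule.mem_span_singleton.1 hc
  set u := (K.comap Wᗮ.subtype).starProjection x with hu
  have huK : (u : E) ∈ K := (K.comap Wᗮ.subtype).starProjection_apply_mem x
  have hux : ⟪(u : E), x⟫_𝕜 ≠ 0 := by
    intro h
    have hre := (K.comap Wᗮ.subtype).re_inner_starProjection_eq_normSq x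
    rw [← hu, Submodule.coe_inner, h] at hre
    rw [map_zero, eq_comm, sq_eq_zero_iff, norm_eq_zero] at hre
    exact hx (by rw [hu, Submodule.starProjection_apply, hre, Submodule.coe_zero])
  have hc : c = 0 := by
    have h := hzK u huK
    rwa [inner_add_right, inner_smul_right, Submodule.inner_left_of_mem_orthogonal hw u.2,
      add_zero, mul_eq_zero, or_iff_left hux] at h
  rw [hc, zero_smul, zero_add] at hzK ⊢
  exact hW w hw hzK

end Geometry

section RandomSubspace

variable {𝕜 E Ω : Type*} [RCLike 𝕜] [NormedAddCommGroup E] [InnerProductSpace 𝕜 E]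
  [FiniteDimensional 𝕜 E] [MeasurableSpace Ω]

/-- A random subspace whose distribution is invariant under all linear isometries of the ambient
space. The distribution of a random subspace is encoded as that of its orthogonal projection. -/
def IsUnitarilyInvariant (K : Ω → Submodule 𝕜 E) (μ : Measure Ω) : Prop :=
  ∀ U : E ≃ₗᵢ[𝕜] E, IdentDistrib (fun ω => (K ω).starProjection)
    (fun ω => ((K ω).map (U.toLinearEquiv : E →ₗ[𝕜] E)).starProjection) μ μ

variable {μ : Measure Ω} {K : Ω → Submodule 𝕜 E}

namespace IsUnitarilyInvariant

theorem aemeasurable (hK : IsUnitarilyInvariant K μ) :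
    AEMeasurable (fun ω => (K ω).starProjection) μ :=
  (hK (.refl 𝕜 E)).aemeasurable_fst

theorem comap_subtype (hK : IsUnitarilyInvariant K μ) (V : Submodule 𝕜 E) :
    IsUnitarilyInvariant (fun ω => (K ω).comap V.subtype) μ := by
  intro U
  obtain ⟨U', hU'⟩ := exists_linearIsometryEquiv_extend (V.subtypeₗᵢ.comp U.toLinearIsometry)
  have hsymm : ∀ x : V, U'.symm x = U.symm x := fun x => by
    rw [LinearIsometryEquiv.symm_apply_eq, hU']
    simp
  have hmap : ∀ ω, ((K ω).comap V.subtype).map (U.toLinearEquiv : V →ₗ[𝕜] V) =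
      ((K ω).map (U'.toLinearEquiv : E →ₗ[𝕜] E)).comap V.subtype := fun ω => by
    ext x
    rw [Submodule.mem_map_equiv, Submodule.mem_comap, Submodule.mem_comap, Submodule.mem_map_equiv]
    exact (congrArg (· ∈ K ω) (hsymm x)).symm.to_iff
  have hmeas : Measurable fun T : E →L[𝕜] E => ((1 - T) ∘L V.subtypeL).ker.starProjection := by
    have hcont : Continuous fun T : E →L[𝕜] E => (1 - T) ∘L V.subtypeL := by fun_prop
    exact measurable_starProjection_ker.comp hcont.measurable
  simp only [hmap, starProjection_comap_subtype]
  exact (hK U').comp hmeas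

variable [MeasurableSpace E] [BorelSpace E]

theorem lintegral_enorm_starProjection_rpow_congr (hK : IsUnitarilyInvariant K μ) {x y : E}
    (h : ‖x‖ = ‖y‖) (r : ℝ) :
    ∫⁻ ω, ‖(K ω).starProjection x‖ₑ ^ r ∂μ = ∫⁻ ω, ‖(K ω).starProjection y‖ₑ ^ r ∂μ := by
  obtain ⟨U, rfl⟩ := exists_linearIsometryEquiv_apply_eq (𝕜 := 𝕜) h
  have hmeas : Measurable fun T : E →L[𝕜] E => ‖T (U x)‖ₑ ^ r := by fun_prop
  have hlintegral : ∫⁻ ω, ‖(K ω).starProjection (U x)‖ₑ ^ r ∂μ =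
      ∫⁻ ω, ‖((K ω).map (U.toLinearEquiv : E →ₗ[𝕜] E)).starProjection (U x)‖ₑ ^ r ∂μ :=
    ((hK U).comp hmeas).lintegral_eq
  rw [hlintegral]
  refine lintegral_congr fun ω => ?_
  rw [Submodule.starProjection_map_apply, U.symm_apply_apply, U.enorm_map]

theorem enorm_rpow_mul_lintegral_enorm_starProjection_rpow
    (hK : IsUnitarilyInvariant K μ) (r : ℝ) (y z : E) :
    ‖y‖ₑ ^ r * ∫⁻ ω, ‖(K ω).starProjection z‖ₑ ^ r ∂μ =
      ‖z‖ₑ ^ r * ∫⁻ ω, ‖(K ω).starProjection y‖ₑ ^ r ∂μ := by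
  have hmeas : ∀ x, AEMeasurable (fun ω => ‖(K ω).starProjection x‖ₑ ^ r) μ := fun x => by
    have := hK.aemeasurable
    fun_prop
  have hsmul : ∀ (a : E) (x : E), ‖a‖ₑ ^ r * ∫⁻ ω, ‖(K ω).starProjection x‖ₑ ^ r ∂μ =
      ∫⁻ ω, ‖(K ω).starProjection ((‖a‖ : 𝕜) • x)‖ₑ ^ r ∂μ := fun a x => by
    rw [← lintegral_const_mul'' _ (hmeas x)]
    refine lintegral_congr fun ω => ?_
    rw [map_smul, enorm_smul, ENNReal.mul_rpow_of_ne_top enorm_ne_top enorm_ne_top]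
    rw [← enorm_norm ((‖a‖ : ℝ) : 𝕜), RCLike.norm_ofReal, abs_norm, enorm_norm]
  rw [hsmul, hsmul]
  exact hK.lintegral_enorm_starProjection_rpow_congr (by simp [norm_smul, mul_comm]) r

theorem aemeasurable_starProjection_apply_prod (hK : IsUnitarilyInvariant K μ) (γ : Measure E) :
    AEMeasurable (fun p : E × Ω => (K p.2).starProjection p.1) (γ.prod μ) := by
  have := FiniteDimensional.proper_rclike 𝕜 E
  have hsnd : AEMeasurable (fun p : E × Ω => (K p.2).starProjection) (γ.prod μ) :=
    hK.aemeasurable.comp_quasiMeasurePreserving Measure.quasiMeasurePreserving_snd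
  have happly : Measurable fun p : (E →L[𝕜] E) × E => p.1 p.2 :=
    Continuous.measurable (by fun_prop)
  exact happly.comp_aemeasurable (hsnd.prodMk measurable_fst.aemeasurable)

variable [IsProbabilityMeasure μ] {k : ℕ}

theorem lintegral_enorm_starProjection_rpow {r : ℝ} (hK : IsUnitarilyInvariant K μ)
    (hk : ∀ᵐ ω ∂μ, finrank 𝕜 (K ω) = k) (hr₀ : 0 ≤ r) (hr : r < finrank ℝ 𝕜 * k) (y : E) :
    ∫⁻ ω, ‖(K ω).starProjection y‖ₑ ^ (-r) ∂μ =
      ENNReal.ofReal (gaussianNegMoment (finrank ℝ 𝕜 * k) r /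
        gaussianNegMoment (finrank ℝ 𝕜 * finrank 𝕜 E) r) * ‖y‖ₑ ^ (-r) := by
  obtain ⟨γ, _, hγ⟩ := exists_isProbabilityMeasure_lintegral_enorm_starProjection_rpow 𝕜 E
  have hrE : r < finrank ℝ 𝕜 * finrank 𝕜 E := by
    obtain ⟨ω, hω⟩ := hk.exists
    have : (k : ℝ) ≤ finrank 𝕜 E := by exact_mod_cast hω ▸ (K ω).finrank_le
    exact hr.trans_le (by gcongr)
  set q := gaussianNegMoment (finrank ℝ 𝕜 * k) r
  set qE := gaussianNegMoment (finrank ℝ 𝕜 * finrank 𝕜 E) r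
  have hqE : 0 < qE := gaussianNegMoment_pos hr₀ hrE
  have hγE : ∫⁻ z, ‖z‖ₑ ^ (-r) ∂γ = ENNReal.ofReal qE := by
    simpa only [finrank_top, Submodule.starProjection_top', one_apply_eq_self] using
      hγ ⊤ r hr₀ (by rwa [finrank_top])
  have hjoint := (hK.aemeasurable_starProjection_apply_prod γ).enorm.pow_const (-r)
  have hswap : ∫⁻ z, ∫⁻ ω, ‖(K ω).starProjection z‖ₑ ^ (-r) ∂μ ∂γ = ENNReal.ofReal q := by
    rw [lintegral_lintegral_swap hjoint]
    calc _ = ∫⁻ _, ENNReal.ofReal q ∂μ := lintegral_congr_ae <| hk.mono fun ω hω => by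
          simpa only [hω] using hγ (K ω) r hr₀ (by rwa [hω])
      _ = _ := by simp
  have haverage : ‖y‖ₑ ^ (-r) * ENNReal.ofReal q =
      ENNReal.ofReal qE * ∫⁻ ω, ‖(K ω).starProjection y‖ₑ ^ (-r) ∂μ := by
    rw [← hswap, ← hγE, ← lintegral_const_mul'' _ hjoint.lintegral_prod_right',
      ← lintegral_mul_const _ (by fun_prop)]
    exact lintegral_congr fun z => hK.enorm_rpow_mul_lintegral_enorm_starProjection_rpow (-r) y z
  rw [ENNReal.ofReal_div_of_pos hqE, ← ENNReal.mul_div_right_comm,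
    ENNReal.eq_div_iff (ENNReal.ofReal_pos.2 hqE).ne' ENNReal.ofReal_ne_top, ← haverage, mul_comm]

theorem ae_starProjection_ne_zero (hK : IsUnitarilyInvariant K μ)
    (hk : ∀ᵐ ω ∂μ, finrank 𝕜 (K ω) = k) (hk₀ : 0 < k) {y : E} (hy : y ≠ 0) :
    ∀ᵐ ω ∂μ, (K ω).starProjection y ≠ 0 := by
  have hβ : (0 : ℝ) < finrank ℝ 𝕜 := by exact_mod_cast finrank_pos
  have hr : (finrank ℝ 𝕜 : ℝ) / 2 < finrank ℝ 𝕜 * k := by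
    have : (1 : ℝ) ≤ k := by exact_mod_cast hk₀
    nlinarith
  have hlt : ∫⁻ ω, ‖(K ω).starProjection y‖ₑ ^ (-(finrank ℝ 𝕜 / 2 : ℝ)) ∂μ ≠ ∞ := by
    rw [hK.lintegral_enorm_starProjection_rpow hk (by positivity) hr]
    refine ENNReal.mul_ne_top ENNReal.ofReal_ne_top ?_
    simp [ENNReal.rpow_eq_top_iff, hy]
  have hmeas : AEMeasurable
      (fun ω => ‖(K ω).starProjection y‖ₑ ^ (-(finrank ℝ 𝕜 / 2 : ℝ))) μ := by
    have := hK.aemeasurable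
    fun_prop
  filter_upwards [ae_lt_top' hmeas hlt] with ω hω h
  simp [h, hβ] at hω

theorem ae_disjoint_orthogonal (hK : IsUnitarilyInvariant K μ)
    (hk : ∀ᵐ ω ∂μ, finrank 𝕜 (K ω) = k) {W : Submodule 𝕜 E} (hW : finrank 𝕜 W ≤ k) :
    ∀ᵐ ω ∂μ, Disjoint W (K ω)ᗮ := by
  induction hd : finrank 𝕜 W generalizing W with
  | zero => simp [Submodule.finrank_eq_zero.1 hd]
  | succ d ih =>
    obtain ⟨x, hxW, hx⟩ := W.ne_bot_iff.1 fun h => by subst h; simp at hd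
    obtain ⟨W', hsup, hxW', hdim⟩ :
        ∃ W' : Submodule 𝕜 E, 𝕜 ∙ x ⊔ W' = W ∧ x ∈ W'ᗮ ∧ finrank 𝕜 W' = d := by
      have hle : 𝕜 ∙ x ≤ W := (Submodule.span_singleton_le_iff_mem x W).2 hxW
      refine ⟨(𝕜 ∙ x)ᗮ ⊓ W, Submodule.sup_orthogonal_inf_of_hasOrthogonalProjection hle,
        Submodule.orthogonal_le inf_le_left
          ((𝕜 ∙ x).le_orthogonal_orthogonal (Submodule.mem_span_singleton_self x)), ?_⟩
      have := Submodule.finrank_add_inf_finrank_orthogonal hle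
      rw [finrank_span_singleton hx] at this
      omega
    have hdisj := ih (W := W') (by omega) hdim
    have hfinrank : ∀ᵐ ω ∂μ, finrank 𝕜 ((K ω).comap W'ᗮ.subtype) = k - d := by
      filter_upwards [hdisj, hk] with ω hω hkω
      have := finrank_comap_subtype_orthogonal_add_finrank hω
      omega
    filter_upwards [hdisj, (hK.comap_subtype W'ᗮ).ae_starProjection_ne_zero hfinrank
      (y := ⟨x, hxW'⟩) (by omega) (by simpa using hx)] with ω hω hxω
    rw [← hsup]
    exact disjoint_span_singleton_sup_orthogonal (x := ⟨x, hxW'⟩) hω hxω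

end IsUnitarilyInvariant

end RandomSubspace

section Gram

variable {𝕜 E ι : Type*} [RCLike 𝕜] [NormedAddCommGroup E] [InnerProductSpace 𝕜 E]

theorem inner_sum_inv_gram_smul [Fintype ι] [DecidableEq ι] {v : ι → E}
    (hv : LinearIndependent 𝕜 v) (k i : ι) :
    ⟪v k, ∑ j, (Matrix.gram 𝕜 v)⁻¹ j i • v j⟫_𝕜 = (1 : Matrix ι ι 𝕜) k i := by
  have hdet := isUnit_iff_ne_zero.2 (Matrix.det_gram_ne_zero_iff_linearIndependent.2 hv)
  rw [← Matrix.mul_nonsing_inv _ hdet, Matrix.mul_apply, inner_sum]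
  exact Finset.sum_congr rfl fun j _ => by rw [inner_smul_right, Matrix.gram_apply, mul_comm]

variable [FiniteDimensional 𝕜 E]

theorem inv_gram_apply_self [Fintype ι] [DecidableEq ι] {v : ι → E}
    (hv : LinearIndependent 𝕜 v) (i : ι) :
    (Matrix.gram 𝕜 v)⁻¹ i i =
      ((‖(Submodule.span 𝕜 (v '' {i}ᶜ))ᗮ.starProjection (v i)‖ ^ 2)⁻¹ : ℝ) := by
  set W := Submodule.span 𝕜 (v '' {i}ᶜ)
  have hvW : ∀ j ≠ i, v j ∈ W := fun j hj => Submodule.subset_span ⟨j, hj, rfl⟩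
  set w := ∑ j, (Matrix.gram 𝕜 v)⁻¹ j i • v j with hw
  have hwW : w ∈ Wᗮ := by
    have hspan : W ≤ (𝕜 ∙ w)ᗮ := by
      refine Submodule.span_le.2 ?_
      rintro _ ⟨k, hk, rfl⟩
      rw [SetLike.mem_coe, Submodule.mem_orthogonal_singleton_iff_inner_left,
        inner_sum_inv_gram_smul hv, Matrix.one_apply_ne hk]
    exact fun u hu => Submodule.mem_orthogonal_singleton_iff_inner_left.1 (hspan hu)
  have hproj : Wᗮ.starProjection w = w := Submodule.starProjection_eq_self_iff.2 hwW
  have hwi : w = (Matrix.gram 𝕜 v)⁻¹ i i • Wᗮ.starProjection (v i) := by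
    conv_lhs => rw [← hproj, hw, map_sum]
    rw [Finset.sum_eq_single_of_mem i (Finset.mem_univ i) fun j _ hj => ?_, map_smul]
    rw [map_smul, Submodule.starProjection_orthogonal_apply_eq_zero (hvW j hj), smul_zero]
  have hinner : ⟪Wᗮ.starProjection (v i), w⟫_𝕜 = 1 := by
    rw [Submodule.inner_starProjection_left_eq_right, hproj, inner_sum_inv_gram_smul hv,
      Matrix.one_apply_eq]
  rw [hwi, inner_smul_right, inner_self_eq_norm_sq_to_K] at hinner
  rw [eq_inv_of_mul_eq_one_left hinner]
  norm_cast

theorem starProjection_orthogonal_map_starProjection (K W : Submodule 𝕜 E) (x : E) :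
    (W.map (K.starProjection : E →ₗ[𝕜] E))ᗮ.starProjection (K.starProjection x) =
      (K.comap Wᗮ.subtype).starProjection (Wᗮ.orthogonalProjectionOnto x) := by
  set z := (K.comap Wᗮ.subtype).starProjection (Wᗮ.orthogonalProjectionOnto x)
  have hzK : K.starProjection (z : E) = z :=
    Submodule.starProjection_eq_self_iff.2 ((K.comap Wᗮ.subtype).starProjection_apply_mem _)
  refine Submodule.eq_starProjection_of_mem_of_inner_eq_zero ?_ fun y hy => ?_
  · rintro _ ⟨w, hw, rfl⟩
    rw [ContinuousLinearMap.coe_coe, Submodule.inner_starProjection_left_eq_right, hzK]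
    exact z.2 w hw
  · have hyW : K.starProjection y ∈ Wᗮ := fun w hw => by
      rw [← Submodule.inner_starProjection_left_eq_right]
      exact hy _ (Submodule.mem_map_of_mem hw)
    rw [← hzK, ← map_sub, Submodule.inner_starProjection_left_eq_right,
      ← sub_add_sub_cancel x (Wᗮ.starProjection x), inner_add_left,
      Submodule.starProjection_inner_eq_zero _ _ hyW, zero_add]
    exact (K.comap Wᗮ.subtype).starProjection_inner_eq_zero _ ⟨_, hyW⟩
      (K.starProjection_apply_mem y)

theorem starProjection_orthogonal_span_image_starProjection (K : Submodule 𝕜 E) (v : ι → E)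
    (s : Set ι) (x : E) :
    (Submodule.span 𝕜 ((fun j => K.starProjection (v j)) '' s))ᗮ.starProjection
        (K.starProjection x) =
      (K.comap (Submodule.span 𝕜 (v '' s))ᗮ.subtype).starProjection
        ((Submodule.span 𝕜 (v '' s))ᗮ.orthogonalProjectionOnto x) := by
  have hspan : Submodule.span 𝕜 ((fun j => K.starProjection (v j)) '' s) =
      (Submodule.span 𝕜 (v '' s)).map (K.starProjection : E →ₗ[𝕜] E) := by
    rw [Submodule.map_span, image_image]
    rfl
  simp only [hspan, starProjection_orthogonal_map_starProjection]

theorem linearIndependent_starProjection {K : Submodule 𝕜 E} {v : ι → E}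
    (hv : LinearIndependent 𝕜 v) (hK : Disjoint (Submodule.span 𝕜 (range v)) Kᗮ) :
    LinearIndependent 𝕜 fun j => K.starProjection (v j) :=
  hv.map (f := (K.starProjection : E →ₗ[𝕜] E)) (by rwa [Submodule.ker_starProjection])

end Gram

section RowSpace

variable {m n : ℕ}

/-- The row space of `Φ`: the span of its conjugated rows, encoded as the orthogonal complement of
the kernel. -/
noncomputable def rowSpace (Φ : Matrix (Fin m) (Fin n) ℂ) :
    Submodule ℂ (EuclideanSpace ℂ (Fin n)) :=
  (Matrix.toEuclideanLin Φ).toContinuousLinearMap.kerᗮ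

theorem isHermitian_rowProjection (Φ : Matrix (Fin m) (Fin n) ℂ) :
    (rowProjection Φ).IsHermitian := by
  simp [Matrix.IsHermitian, rowProjection, Matrix.conjTranspose_nonsing_inv, Matrix.mul_assoc]

theorem mul_rowProjection {Φ : Matrix (Fin m) (Fin n) ℂ} (hΦ : IsUnit (Φ * Φᴴ)) :
    Φ * rowProjection Φ = Φ := by
  rw [rowProjection, ← Matrix.mul_assoc, ← Matrix.mul_assoc,
    Matrix.mul_nonsing_inv _ ((Matrix.isUnit_iff_isUnit_det _).1 hΦ), Matrix.one_mul]

theorem starProjection_rowSpace {Φ : Matrix (Fin m) (Fin n) ℂ} (hΦ : IsUnit (Φ * Φᴴ))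
    (x : EuclideanSpace ℂ (Fin n)) :
    (rowSpace Φ).starProjection x = Matrix.toEuclideanLin (rowProjection Φ) x := by
  refine Submodule.eq_starProjection_of_mem_orthogonal ?_ ?_
  · intro y hy
    replace hy : Matrix.toEuclideanLin Φ y = 0 := hy
    rw [← Matrix.isSymmetric_toEuclideanLin_iff.2 (isHermitian_rowProjection Φ), rowProjection,
      Matrix.toLpLin_mul_same, LinearMap.comp_apply, hy, map_zero, inner_zero_left]
  · refine Submodule.le_orthogonal_orthogonal _ ?_
    change Matrix.toEuclideanLin Φ (x - Matrix.toEuclideanLin (rowProjection Φ) x) = 0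
    rw [map_sub, ← LinearMap.comp_apply, ← Matrix.toLpLin_mul_same, mul_rowProjection hΦ, sub_self]

open scoped ComplexOrder in
theorem finrank_rowSpace {Φ : Matrix (Fin m) (Fin n) ℂ} (hΦ : IsUnit (Φ * Φᴴ)) :
    finrank ℂ (rowSpace Φ) = m := by
  have hrank : Φ.rank = m := by
    rw [← Matrix.rank_self_mul_conjTranspose, Matrix.rank_of_isUnit _ hΦ, Fintype.card_fin]
  rw [Matrix.rank_eq_finrank_range_toLin Φ (EuclideanSpace.basisFun _ ℂ).toBasis
    (EuclideanSpace.basisFun _ ℂ).toBasis, ← Matrix.toEuclideanLin_eq_toLin_orthonormal] at hrank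
  have hker := (Matrix.toEuclideanLin Φ).finrank_range_add_finrank_ker
  have horth := (Matrix.toEuclideanLin Φ).ker.finrank_add_finrank_orthogonal
  rw [rowSpace, LinearMap.coe_toContinuousLinearMap]
  omega

theorem le_of_isUnit_mul_conjTranspose {Φ : Matrix (Fin m) (Fin n) ℂ} (hΦ : IsUnit (Φ * Φᴴ)) :
    m ≤ n := by
  simpa only [finrank_rowSpace hΦ, finrank_euclideanSpace_fin] using (rowSpace Φ).finrank_le

theorem measurable_starProjection_rowSpace :
    Measurable fun A : Fin m → Fin n → ℂ => (rowSpace (Matrix.of A)).starProjection := by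
  let L : (Fin m → Fin n → ℂ) →ₗ[ℂ] EuclideanSpace ℂ (Fin n) →L[ℂ] EuclideanSpace ℂ (Fin m) :=
    LinearMap.toContinuousLinearMap.toLinearMap ∘ₗ Matrix.toEuclideanLin.toLinearMap ∘ₗ
      (Matrix.ofLinearEquiv ℂ).toLinearMap
  have hL : Measurable fun A => (L A).ker.starProjection :=
    measurable_starProjection_ker.comp L.continuous_of_finiteDimensional.measurable
  have hsub : Continuous fun T : EuclideanSpace ℂ (Fin n) →L[ℂ] EuclideanSpace ℂ (Fin n) =>
      1 - T := by fun_prop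
  simp only [rowSpace, Submodule.starProjection_orthogonal']
  exact hsub.measurable.comp hL

/-- The matrix of a linear isometry of `ℂⁿ` in the standard basis, as a unitary matrix. -/
noncomputable def isometryMatrix (U : EuclideanSpace ℂ (Fin n) ≃ₗᵢ[ℂ] EuclideanSpace ℂ (Fin n)) :
    Matrix.unitaryGroup (Fin n) ℂ :=
  ⟨(Matrix.toEuclideanCLM (n := Fin n) (𝕜 := ℂ)).symm (Unitary.linearIsometryEquiv.symm U).1,
    Unitary.map_mem (Matrix.toEuclideanCLM (n := Fin n) (𝕜 := ℂ)).symm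
      (Unitary.linearIsometryEquiv.symm U).2⟩

theorem toEuclideanLin_isometryMatrix
    (U : EuclideanSpace ℂ (Fin n) ≃ₗᵢ[ℂ] EuclideanSpace ℂ (Fin n))
    (x : EuclideanSpace ℂ (Fin n)) :
    Matrix.toEuclideanLin (isometryMatrix U : Matrix (Fin n) (Fin n) ℂ) x = U x := by
  rw [← Matrix.coe_toEuclideanCLM_eq_toEuclideanLin, isometryMatrix, StarAlgEquiv.apply_symm_apply]
  rfl

theorem rowSpace_mul_isometryMatrix (Φ : Matrix (Fin m) (Fin n) ℂ)
    (U : EuclideanSpace ℂ (Fin n) ≃ₗᵢ[ℂ] EuclideanSpace ℂ (Fin n)) :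
    rowSpace (Φ * (isometryMatrix U.symm : Matrix (Fin n) (Fin n) ℂ)) =
      (rowSpace Φ).map
        (U.toLinearEquiv : EuclideanSpace ℂ (Fin n) →ₗ[ℂ] EuclideanSpace ℂ (Fin n)) := by
  have hker :
      (Matrix.toEuclideanLin (Φ * (isometryMatrix U.symm : Matrix (Fin n) (Fin n) ℂ))).ker =
      (Matrix.toEuclideanLin Φ).ker.map
        (U.toLinearEquiv : EuclideanSpace ℂ (Fin n) →ₗ[ℂ] EuclideanSpace ℂ (Fin n)) := by
    ext x
    rw [Submodule.mem_map_equiv, LinearMap.mem_ker, LinearMap.mem_ker, Matrix.toLpLin_mul_same,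
      LinearMap.comp_apply, toEuclideanLin_isometryMatrix]
    rfl
  rw [rowSpace, rowSpace, LinearMap.coe_toContinuousLinearMap, LinearMap.coe_toContinuousLinearMap,
    hker]
  exact (Submodule.map_orthogonal_equiv _ U).symm

theorem IsRightUnitarilyInvariant.isUnitarilyInvariant_rowSpace {Ω : Type*} [MeasurableSpace Ω]
    {μ : Measure Ω} {Φ : Ω → Matrix (Fin m) (Fin n) ℂ} (hΦ : IsRightUnitarilyInvariant μ Φ) :
    IsUnitarilyInvariant (fun ω => rowSpace (Φ ω)) μ := by
  intro U
  let M : Matrix (Fin n) (Fin n) ℂ := isometryMatrix U.symm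
  have hmul : Continuous fun (A : Fin m → Fin n → ℂ) k l => (Matrix.of A * M) k l := by
    simp only [Matrix.mul_apply, Matrix.of_apply]
    fun_prop
  have hident : IdentDistrib (fun ω k l => Φ ω k l) (fun ω k l => (Φ ω * M) k l) μ μ :=
    ⟨hΦ.aemeasurable, hmul.measurable.comp_aemeasurable hΦ.aemeasurable,
      (hΦ.map_mul_eq M (isometryMatrix U.symm).2).symm⟩
  simp only [← rowSpace_mul_isometryMatrix]
  exact hident.comp measurable_starProjection_rowSpace

end RowSpace

section ColumnVectors

variable {n ι : Type*} [Fintype n]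

/-- The `j`-th column of a complex matrix, as a vector with the Euclidean norm, so that `Gᴴ * G` is
the Gram matrix of the columns of `G`. -/
def columnVector (G : Matrix n ι ℂ) (j : ι) : EuclideanSpace ℂ n :=
  WithLp.toLp 2 (G.col j)

theorem conjTranspose_mul_self_eq_gram (G : Matrix n ι ℂ) :
    Gᴴ * G = Matrix.gram ℂ (columnVector G) := by
  ext i j
  simp [Matrix.mul_apply, columnVector, Matrix.gram_apply, PiLp.inner_apply, mul_comm]

theorem columnVector_mul [DecidableEq n] (A : Matrix n n ℂ) (G : Matrix n ι ℂ) (j : ι) :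
    columnVector (A * G) j = Matrix.toEuclideanLin A (columnVector G j) := by
  ext k
  simp [columnVector, Matrix.mul_apply, Matrix.mulVec, dotProduct]

end ColumnVectors

section CramerRaoBound

variable {m n p : ℕ}

theorem isUnit_fisherInformation_iff {σ : ℝ} (hσ : σ ≠ 0) (G : Matrix (Fin n) (Fin p) ℂ) :
    IsUnit (fisherInformation σ G) ↔ LinearIndependent ℂ (columnVector G) := by
  have hc : 1 / (σ : ℂ) ^ 2 ≠ 0 := by simp [hσ]
  rw [fisherInformation, conjTranspose_mul_self_eq_gram, Matrix.isUnit_iff_isUnit_det,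
    Matrix.det_smul, isUnit_iff_ne_zero, mul_ne_zero_iff, and_iff_right (pow_ne_zero _ hc),
    Matrix.det_gram_ne_zero_iff_linearIndependent]

theorem crb_fisherInformation {σ : ℝ} (hσ : σ ≠ 0) {G : Matrix (Fin n) (Fin p) ℂ}
    (hG : LinearIndependent ℂ (columnVector G)) (i : Fin p) :
    crb (fisherInformation σ G) i =
      σ ^ 2 * (‖(Submodule.span ℂ (columnVector G '' {i}ᶜ))ᗮ.starProjection
        (columnVector G i)‖ ^ 2)⁻¹ := by
  have hdet : IsUnit (Matrix.gram ℂ (columnVector G)).det :=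
    isUnit_iff_ne_zero.2 (Matrix.det_gram_ne_zero_iff_linearIndependent.2 hG)
  have hc : 1 / (σ : ℂ) ^ 2 ≠ 0 := by simp [hσ]
  have hinv : (fisherInformation σ G)⁻¹ = (σ : ℂ) ^ 2 • (Matrix.gram ℂ (columnVector G))⁻¹ := by
    rw [fisherInformation, conjTranspose_mul_self_eq_gram]
    simpa [Units.smul_def] using Matrix.inv_smul' _ (Units.mk0 _ hc) hdet
  rw [crb, hinv, Matrix.smul_apply, inv_gram_apply_self hG, smul_eq_mul, ← Complex.ofReal_pow]
  exact (congrArg Complex.re (Complex.ofReal_mul _ _).symm).trans (Complex.ofReal_re _)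

/-- The orthogonal complement of the columns of `G` other than the `i`-th one. -/
noncomputable def residualSpace (G : Matrix (Fin n) (Fin p) ℂ) (i : Fin p) :
    Submodule ℂ (EuclideanSpace ℂ (Fin n)) :=
  (Submodule.span ℂ (columnVector G '' {i}ᶜ))ᗮ

/-- The residual of the `i`-th column of `G` after regression on the other columns. -/
noncomputable def residual (G : Matrix (Fin n) (Fin p) ℂ) (i : Fin p) : residualSpace G i :=
  (residualSpace G i).orthogonalProjectionOnto (columnVector G i)

/-- The part of the residual space of the `i`-th column of `G` that survives compression by `Φ`. -/
noncomputable def compressedResidualSpace (Φ : Matrix (Fin m) (Fin n) ℂ)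
    (G : Matrix (Fin n) (Fin p) ℂ) (i : Fin p) : Submodule ℂ (residualSpace G i) :=
  (rowSpace Φ).comap (residualSpace G i).subtype

/-- The residual of the `i`-th column of `rowProjection Φ * G` after regression on the other
columns, see `crb_compressedFisherInformation`. -/
noncomputable def compressedResidual (Φ : Matrix (Fin m) (Fin n) ℂ)
    (G : Matrix (Fin n) (Fin p) ℂ) (i : Fin p) : residualSpace G i :=
  Submodule.starProjection (𝕜 := ℂ) (compressedResidualSpace Φ G i) (residual G i)

theorem crb_fisherInformation_eq_norm_residual {σ : ℝ} (hσ : σ ≠ 0)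
    {G : Matrix (Fin n) (Fin p) ℂ} (hG : LinearIndependent ℂ (columnVector G)) (i : Fin p) :
    crb (fisherInformation σ G) i = σ ^ 2 * (‖residual G i‖ ^ 2)⁻¹ :=
  crb_fisherInformation hσ hG i

theorem columnVector_rowProjection_mul {Φ : Matrix (Fin m) (Fin n) ℂ} (hΦ : IsUnit (Φ * Φᴴ))
    (G : Matrix (Fin n) (Fin p) ℂ) :
    columnVector (rowProjection Φ * G) = fun j => (rowSpace Φ).starProjection (columnVector G j) :=
  funext fun j => by rw [columnVector_mul, starProjection_rowSpace hΦ]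

theorem isUnit_compressedFisherInformation {σ : ℝ} (hσ : σ ≠ 0) {Φ : Matrix (Fin m) (Fin n) ℂ}
    (hΦ : IsUnit (Φ * Φᴴ)) {G : Matrix (Fin n) (Fin p) ℂ}
    (hG : LinearIndependent ℂ (columnVector G))
    (hGΦ : Disjoint (Submodule.span ℂ (range (columnVector G))) (rowSpace Φ)ᗮ) :
    IsUnit (compressedFisherInformation σ Φ G) := by
  rw [compressedFisherInformation, isUnit_fisherInformation_iff hσ,
    columnVector_rowProjection_mul hΦ]
  exact linearIndependent_starProjection hG hGΦ

theorem crb_compressedFisherInformation {σ : ℝ} (hσ : σ ≠ 0) {Φ : Matrix (Fin m) (Fin n) ℂ}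
    (hΦ : IsUnit (Φ * Φᴴ)) {G : Matrix (Fin n) (Fin p) ℂ}
    (hG : IsUnit (compressedFisherInformation σ Φ G)) (i : Fin p) :
    crb (compressedFisherInformation σ Φ G) i =
      σ ^ 2 * (‖compressedResidual Φ G i‖ ^ 2)⁻¹ := by
  rw [compressedFisherInformation, isUnit_fisherInformation_iff hσ] at hG
  rw [compressedFisherInformation, crb_fisherInformation hσ hG, columnVector_rowProjection_mul hΦ,
    starProjection_orthogonal_span_image_starProjection]
  rfl

theorem finrank_span_columnVector_image_compl_add_one {G : Matrix (Fin n) (Fin p) ℂ}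
    (hG : LinearIndependent ℂ (columnVector G)) (i : Fin p) :
    finrank ℂ (Submodule.span ℂ (columnVector G '' {i}ᶜ)) + 1 = p := by
  have hind : LinearIndependent ℂ fun j : ({i}ᶜ : Set (Fin p)) => columnVector G j :=
    hG.comp _ Subtype.val_injective
  rw [image_eq_range, finrank_span_eq_card hind, Fintype.card_compl_set,
    Fintype.card_fin, card_singleton, Nat.sub_add_cancel i.pos]

theorem finrank_residualSpace_add {G : Matrix (Fin n) (Fin p) ℂ}
    (hG : LinearIndependent ℂ (columnVector G)) (i : Fin p) :
    finrank ℂ (residualSpace G i) + p = n + 1 := by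
  have h := (Submodule.span ℂ (columnVector G '' {i}ᶜ)).finrank_add_finrank_orthogonal
  have := finrank_span_columnVector_image_compl_add_one hG i
  rw [finrank_euclideanSpace_fin] at h
  rw [residualSpace]
  omega

theorem finrank_compressedResidualSpace_add {Φ : Matrix (Fin m) (Fin n) ℂ} (hΦ : IsUnit (Φ * Φᴴ))
    {G : Matrix (Fin n) (Fin p) ℂ} (hG : LinearIndependent ℂ (columnVector G))
    (hGΦ : Disjoint (Submodule.span ℂ (range (columnVector G))) (rowSpace Φ)ᗮ) (i : Fin p) :
    finrank ℂ (compressedResidualSpace Φ G i) + p = m + 1 := by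
  have h := finrank_comap_subtype_orthogonal_add_finrank
    (hGΦ.mono_left (Submodule.span_mono (image_subset_range _ {i}ᶜ)))
  have := finrank_span_columnVector_image_compl_add_one hG i
  rw [finrank_rowSpace hΦ] at h
  rw [compressedResidualSpace, residualSpace]
  omega

theorem residual_ne_zero {G : Matrix (Fin n) (Fin p) ℂ}
    (hG : LinearIndependent ℂ (columnVector G)) (i : Fin p) : residual G i ≠ 0 := by
  rw [residual, Ne, Submodule.orthogonalProjectionOnto_eq_zero_iff, residualSpace,
    Submodule.orthogonal_orthogonal]
  exact hG.notMem_span_image (by simp)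

end CramerRaoBound

theorem enorm_rpow_neg_two_mul {E : Type*} [NormedAddCommGroup E] {x : E} (hx : x ≠ 0) (s : ℕ) :
    ‖x‖ₑ ^ (-(2 * s) : ℝ) = ENNReal.ofReal ((‖x‖ ^ 2)⁻¹ ^ s) := by
  rw [← ofReal_norm, ENNReal.ofReal_rpow_of_pos (norm_pos_iff.2 hx), Real.rpow_neg (norm_nonneg x),
    inv_pow, ← pow_mul]
  exact_mod_cast rfl

theorem integrable_and_integral_eq_of_lintegral_ofReal {α : Type*} [MeasurableSpace α]
    {μ : Measure α} {f : α → ℝ} (hf : AEMeasurable f μ) (hf₀ : 0 ≤ᵐ[μ] f) {c : ℝ} (hc : 0 ≤ c)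
    (h : ∫⁻ a, ENNReal.ofReal (f a) ∂μ = ENNReal.ofReal c) :
    Integrable f μ ∧ ∫ a, f a ∂μ = c := by
  refine ⟨⟨hf.aestronglyMeasurable, ?_⟩, ?_⟩
  · rw [hasFiniteIntegral_iff_ofReal hf₀, h]
    exact ENNReal.ofReal_lt_top
  · rw [integral_eq_lintegral_of_nonneg_ae hf₀ hf.aestronglyMeasurable, h, ENNReal.toReal_ofReal hc]

section RandomCompression

variable {Ω : Type*} [MeasurableSpace Ω] {μ : Measure Ω} {m n p : ℕ}
  {Φ : Ω → Matrix (Fin m) (Fin n) ℂ} {G : Matrix (Fin n) (Fin p) ℂ}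

theorem IsRightUnitarilyInvariant.isUnitarilyInvariant_compressedResidualSpace
    (hΦ : IsRightUnitarilyInvariant μ Φ) (G : Matrix (Fin n) (Fin p) ℂ) (i : Fin p) :
    IsUnitarilyInvariant (𝕜 := ℂ) (E := residualSpace G i)
      (fun ω => compressedResidualSpace (Φ ω) G i) μ :=
  hΦ.isUnitarilyInvariant_rowSpace.comap_subtype (residualSpace G i)

variable [IsProbabilityMeasure μ]

theorem ae_disjoint_span_columnVector (hΦ : IsRightUnitarilyInvariant μ Φ)
    (hrank : ∀ᵐ ω ∂μ, IsUnit (Φ ω * (Φ ω)ᴴ)) (hpm : p ≤ m) (G : Matrix (Fin n) (Fin p) ℂ) :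
    ∀ᵐ ω ∂μ, Disjoint (Submodule.span ℂ (range (columnVector G))) (rowSpace (Φ ω))ᗮ := by
  refine hΦ.isUnitarilyInvariant_rowSpace.ae_disjoint_orthogonal
    (hrank.mono fun ω hω => finrank_rowSpace hω) ((finrank_range_le_card _).trans ?_)
  rwa [Fintype.card_fin]

theorem ae_isUnit_compressedFisherInformation {σ : ℝ} (hσ : σ ≠ 0)
    (hG : LinearIndependent ℂ (columnVector G)) (hΦ : IsRightUnitarilyInvariant μ Φ)
    (hrank : ∀ᵐ ω ∂μ, IsUnit (Φ ω * (Φ ω)ᴴ)) (hpm : p ≤ m) :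
    ∀ᵐ ω ∂μ, IsUnit (compressedFisherInformation σ (Φ ω) G) := by
  filter_upwards [hrank, ae_disjoint_span_columnVector hΦ hrank hpm G] with ω hω hdisj
  exact isUnit_compressedFisherInformation hσ hω hG hdisj

theorem ae_crb_compressedFisherInformation {σ : ℝ} (hσ : σ ≠ 0)
    (hG : LinearIndependent ℂ (columnVector G)) (hΦ : IsRightUnitarilyInvariant μ Φ)
    (hrank : ∀ᵐ ω ∂μ, IsUnit (Φ ω * (Φ ω)ᴴ)) (hpm : p ≤ m) (i : Fin p) :
    (fun ω => crb (compressedFisherInformation σ (Φ ω) G) i) =ᵐ[μ] fun ω =>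
      σ ^ 2 * (‖compressedResidual (Φ ω) G i‖ ^ 2)⁻¹ := by
  filter_upwards [hrank, ae_isUnit_compressedFisherInformation hσ hG hΦ hrank hpm] with ω hω hunit
  exact crb_compressedFisherInformation hσ hω hunit i

theorem ae_finrank_compressedResidualSpace (hG : LinearIndependent ℂ (columnVector G))
    (hΦ : IsRightUnitarilyInvariant μ Φ) (hrank : ∀ᵐ ω ∂μ, IsUnit (Φ ω * (Φ ω)ᴴ)) (hpm : p ≤ m)
    (i : Fin p) : ∀ᵐ ω ∂μ, finrank ℂ (compressedResidualSpace (Φ ω) G i) = m + 1 - p := by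
  filter_upwards [hrank, ae_disjoint_span_columnVector hΦ hrank hpm G] with ω hω hdisj
  exact Nat.eq_sub_of_add_eq (finrank_compressedResidualSpace_add hω hG hdisj i)

theorem aemeasurable_crb_compressedFisherInformation {σ : ℝ} (hσ : σ ≠ 0)
    (hG : LinearIndependent ℂ (columnVector G)) (hΦ : IsRightUnitarilyInvariant μ Φ)
    (hrank : ∀ᵐ ω ∂μ, IsUnit (Φ ω * (Φ ω)ᴴ)) (hpm : p ≤ m) (i : Fin p) :
    AEMeasurable (fun ω => crb (compressedFisherInformation σ (Φ ω) G) i) μ := by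
  have hproj := (hΦ.isUnitarilyInvariant_compressedResidualSpace G i).aemeasurable
  refine AEMeasurable.congr ?_ (ae_crb_compressedFisherInformation hσ hG hΦ hrank hpm i).symm
  simp only [compressedResidual]
  fun_prop

theorem lintegral_norm_compressedResidual_pow (hG : LinearIndependent ℂ (columnVector G))
    (hΦ : IsRightUnitarilyInvariant μ Φ) (hrank : ∀ᵐ ω ∂μ, IsUnit (Φ ω * (Φ ω)ᴴ)) {s : ℕ}
    (hs : s + p ≤ m) (i : Fin p) :
    ∫⁻ ω, ENNReal.ofReal ((‖compressedResidual (Φ ω) G i‖ ^ 2)⁻¹ ^ s) ∂μ =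
      ENNReal.ofReal (gaussianNegMoment (2 * (m + 1 - p)) (2 * s) /
        gaussianNegMoment (2 * (n + 1 - p)) (2 * s) * (‖residual G i‖ ^ 2)⁻¹ ^ s) := by
  have hpm : p ≤ m := by omega
  have hK := hΦ.isUnitarilyInvariant_compressedResidualSpace G i
  have hk := ae_finrank_compressedResidualSpace hG hΦ hrank hpm i
  have hm : ((m + 1 - p : ℕ) : ℝ) = m + 1 - p := by
    rw [Nat.cast_sub (by omega), Nat.cast_succ]
  have hn : (finrank ℂ (residualSpace G i) : ℝ) = n + 1 - p :=
    eq_sub_of_add_eq (by exact_mod_cast finrank_residualSpace_add hG i)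
  have hsm : (s : ℝ) + p ≤ m := by exact_mod_cast hs
  have hlintegral := hK.lintegral_enorm_starProjection_rpow hk (r := 2 * s) (by positivity)
    (by rw [hm, Complex.finrank_real_complex]; push_cast; linarith) (residual G i)
  have hres := residual_ne_zero hG i
  rw [Complex.finrank_real_complex, Nat.cast_ofNat, hm, hn, enorm_rpow_neg_two_mul hres,
    ← ENNReal.ofReal_mul' (by positivity)] at hlintegral
  rw [← hlintegral]
  refine lintegral_congr_ae ?_
  filter_upwards [hK.ae_starProjection_ne_zero hk (by omega) hres] with ω hω
  exact (enorm_rpow_neg_two_mul hω s).symm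

theorem integrable_and_integral_crb_compressedFisherInformation_pow {σ : ℝ} (hσ : σ ≠ 0)
    (hG : LinearIndependent ℂ (columnVector G)) (hΦ : IsRightUnitarilyInvariant μ Φ)
    (hrank : ∀ᵐ ω ∂μ, IsUnit (Φ ω * (Φ ω)ᴴ)) {s : ℕ} (hs : s + p ≤ m) (i : Fin p) :
    Integrable (fun ω => crb (compressedFisherInformation σ (Φ ω) G) i ^ s) μ ∧
      ∫ ω, crb (compressedFisherInformation σ (Φ ω) G) i ^ s ∂μ =
        gaussianNegMoment (2 * (m + 1 - p)) (2 * s) /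
          gaussianNegMoment (2 * (n + 1 - p)) (2 * s) * crb (fisherInformation σ G) i ^ s := by
  have hpm : p ≤ m := by omega
  have hcrb := ae_crb_compressedFisherInformation hσ hG hΦ hrank hpm i
  have hmeas := aemeasurable_crb_compressedFisherInformation hσ hG hΦ hrank hpm i
  have hnonneg : 0 ≤ᵐ[μ] fun ω => crb (compressedFisherInformation σ (Φ ω) G) i ^ s := by
    filter_upwards [hcrb] with ω hω
    simp only [Pi.zero_apply, hω]
    positivity
  have hsm : (s : ℝ) + p ≤ m := by exact_mod_cast hs
  have hsn : (s : ℝ) + p ≤ n := by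
    obtain ⟨ω, hω⟩ := hrank.exists
    exact hsm.trans (by exact_mod_cast le_of_isUnit_mul_conjTranspose hω)
  have hqm : 0 < gaussianNegMoment (2 * (m + 1 - p)) (2 * s) :=
    gaussianNegMoment_pos (by positivity) (by linarith)
  have hqn : 0 < gaussianNegMoment (2 * (n + 1 - p)) (2 * s) :=
    gaussianNegMoment_pos (by positivity) (by linarith)
  refine integrable_and_integral_eq_of_lintegral_ofReal (hmeas.pow_const s) hnonneg ?_ ?_
  · rw [crb_fisherInformation_eq_norm_residual hσ hG]
    positivity
  · have hpow : 0 ≤ (σ ^ 2) ^ s := by positivity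
    rw [crb_fisherInformation_eq_norm_residual hσ hG, mul_pow, mul_left_comm,
      ENNReal.ofReal_mul hpow, ← lintegral_norm_compressedResidual_pow hG hΦ hrank hs,
      ← lintegral_const_mul' _ _ ENNReal.ofReal_ne_top]
    refine lintegral_congr_ae (hcrb.mono fun ω hω => ?_)
    simp only [hω, mul_pow, ENNReal.ofReal_mul hpow]

theorem integrable_and_integral_crb_compressedFisherInformation {σ : ℝ} (hσ : σ ≠ 0)
    (hG : LinearIndependent ℂ (columnVector G)) (hΦ : IsRightUnitarilyInvariant μ Φ)
    (hrank : ∀ᵐ ω ∂μ, IsUnit (Φ ω * (Φ ω)ᴴ)) (hpm : p < m) (i : Fin p) :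
    Integrable (fun ω => crb (compressedFisherInformation σ (Φ ω) G) i) μ ∧
      ∫ ω, crb (compressedFisherInformation σ (Φ ω) G) i ∂μ =
        (((n : ℝ) - p) / ((m : ℝ) - p)) * crb (fisherInformation σ G) i := by
  have hm : (p : ℝ) < m := by exact_mod_cast hpm
  have hn : (p : ℝ) < n := by
    obtain ⟨ω, hω⟩ := hrank.exists
    exact hm.trans_le (by exact_mod_cast le_of_isUnit_mul_conjTranspose hω)
  have hmoment := integrable_and_integral_crb_compressedFisherInformation_pow hσ hG hΦ hrank
    (s := 1) (by omega) i
  simp only [pow_one, Nat.cast_one, mul_one] at hmoment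
  rw [gaussianNegMoment_two (by linarith), gaussianNegMoment_two (by linarith)] at hmoment
  refine ⟨hmoment.1, hmoment.2.trans ?_⟩
  rw [inv_div_inv]
  congr 2 <;> ring

theorem memLp_two_and_integral_crb_sq_compressedFisherInformation {σ : ℝ} (hσ : σ ≠ 0)
    (hG : LinearIndependent ℂ (columnVector G)) (hΦ : IsRightUnitarilyInvariant μ Φ)
    (hrank : ∀ᵐ ω ∂μ, IsUnit (Φ ω * (Φ ω)ᴴ)) (hpm : p + 1 < m) (i : Fin p) :
    MemLp (fun ω => crb (compressedFisherInformation σ (Φ ω) G) i) 2 μ ∧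
      ∫ ω, crb (compressedFisherInformation σ (Φ ω) G) i ^ 2 ∂μ =
        (((n : ℝ) - p) * ((n : ℝ) - p - 1) / (((m : ℝ) - p) * ((m : ℝ) - p - 1))) *
          crb (fisherInformation σ G) i ^ 2 := by
  have hm : (p : ℝ) + 1 < m := by exact_mod_cast hpm
  have hn : (p : ℝ) + 1 < n := by
    obtain ⟨ω, hω⟩ := hrank.exists
    exact hm.trans_le (by exact_mod_cast le_of_isUnit_mul_conjTranspose hω)
  have hmeas := aemeasurable_crb_compressedFisherInformation hσ hG hΦ hrank (by omega) i
  have hmoment := integrable_and_integral_crb_compressedFisherInformation_pow hσ hG hΦ hrank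
    (s := 2) (by omega) i
  have hfour : (2 * (2 : ℕ) : ℝ) = 4 := by norm_num
  rw [hfour, gaussianNegMoment_four (by linarith), gaussianNegMoment_four (by linarith)] at hmoment
  refine ⟨(memLp_two_iff_integrable_sq hmeas.aestronglyMeasurable).2 hmoment.1,
    hmoment.2.trans ?_⟩
  rw [inv_div_inv]
  congr 2 <;> ring

theorem variance_crb_compressedFisherInformation {σ : ℝ} (hσ : σ ≠ 0)
    (hG : LinearIndependent ℂ (columnVector G)) (hΦ : IsRightUnitarilyInvariant μ Φ)
    (hrank : ∀ᵐ ω ∂μ, IsUnit (Φ ω * (Φ ω)ᴴ)) (hpm : p + 1 < m) (i : Fin p) :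
    variance (fun ω => crb (compressedFisherInformation σ (Φ ω) G) i) μ =
      (((n : ℝ) - m) * ((n : ℝ) - p) / (((m : ℝ) - p - 1) * ((m : ℝ) - p) ^ 2)) *
        crb (fisherInformation σ G) i ^ 2 := by
  obtain ⟨hL2, hsq⟩ :=
    memLp_two_and_integral_crb_sq_compressedFisherInformation hσ hG hΦ hrank hpm i
  have hmean := (integrable_and_integral_crb_compressedFisherInformation hσ hG hΦ hrank
    (by omega) i).2
  have hm : (p : ℝ) + 1 < m := by exact_mod_cast hpm
  have hm₁ : (m : ℝ) - p ≠ 0 := by linarith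
  have hm₂ : (m : ℝ) - p - 1 ≠ 0 := by linarith
  rw [variance_eq_sub hL2]
  simp only [Pi.pow_apply]
  rw [hsq, hmean]
  field_simp
  ring

end RandomCompression

end CompressedCRB

theorem mainTheorem7_general {Ω : Type*} [MeasurableSpace Ω] (μ : Measure Ω)
    [IsProbabilityMeasure μ] (m n p : ℕ) (G : Matrix (Fin n) (Fin p) ℂ) (σ : ℝ) (hσ : σ ≠ 0)
    (hJ : IsUnit (CompressedCRB.fisherInformation σ G))
    (Φ : Ω → Matrix (Fin m) (Fin n) ℂ) (hΦ : CompressedCRB.IsRightUnitarilyInvariant μ Φ)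
    (hΦ_rank : ∀ᵐ ω ∂μ, IsUnit (Φ ω * (Φ ω)ᴴ)) (i : Fin p) :
    (p < m →
      (∀ᵐ ω ∂μ, IsUnit (CompressedCRB.compressedFisherInformation σ (Φ ω) G)) ∧
      Integrable (fun ω =>
        CompressedCRB.crb (CompressedCRB.compressedFisherInformation σ (Φ ω) G) i) μ ∧
      ∫ ω, CompressedCRB.crb (CompressedCRB.compressedFisherInformation σ (Φ ω) G) i ∂μ =
        (((n : ℝ) - p) / ((m : ℝ) - p)) *
          CompressedCRB.crb (CompressedCRB.fisherInformation σ G) i) ∧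
    (p + 1 < m →
      MemLp (fun ω =>
        CompressedCRB.crb (CompressedCRB.compressedFisherInformation σ (Φ ω) G) i) 2 μ ∧
      variance (fun ω =>
        CompressedCRB.crb (CompressedCRB.compressedFisherInformation σ (Φ ω) G) i) μ =
        (((n : ℝ) - m) * ((n : ℝ) - p) / (((m : ℝ) - p - 1) * ((m : ℝ) - p) ^ 2)) *
          (CompressedCRB.crb (CompressedCRB.fisherInformation σ G) i) ^ 2) := by
  have hG := (CompressedCRB.isUnit_fisherInformation_iff hσ G).1 hJ
  refine ⟨fun hpm => ⟨?invertible, ?mean⟩, fun hpm => ⟨?squareIntegrable, ?variance⟩⟩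
  case invertible =>
    exact CompressedCRB.ae_isUnit_compressedFisherInformation hσ hG hΦ hΦ_rank hpm.le
  case mean =>
    exact CompressedCRB.integrable_and_integral_crb_compressedFisherInformation hσ hG hΦ hΦ_rank
      hpm i
  case squareIntegrable =>
    exact (CompressedCRB.memLp_two_and_integral_crb_sq_compressedFisherInformation hσ hG hΦ
      hΦ_rank hpm i).1
  case variance =>
    exact CompressedCRB.variance_crb_compressedFisherInformation hσ hG hΦ hΦ_rank hpm i

theorem mainTheorem7 {Ω : Type*} [MeasurableSpace Ω] (μ : Measure Ω) [IsProbabilityMeasure μ]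
    (m n p : ℕ) (hmn : m + p ≤ n)
    (x : (Fin p → ℝ) → (Fin n → ℂ)) (θ : Fin p → ℝ)
    (hx : ∀ i : Fin p, LineDifferentiableAt ℝ x θ (Pi.single i 1))
    (σ : ℝ) (hσ : 0 < σ)
    (hJ : IsUnit (CompressedCRB.fisherInformation σ (CompressedCRB.sensitivityMatrix x θ)))
    (Φ : Ω → Matrix (Fin m) (Fin n) ℂ)
    (hΦ : CompressedCRB.IsRightUnitarilyInvariant μ Φ)
    (hΦ_rank : ∀ᵐ ω ∂μ, IsUnit (Φ ω * (Φ ω)ᴴ))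
    (i : Fin p) :
    (p < m →
      (∀ᵐ ω ∂μ, IsUnit (CompressedCRB.compressedFisherInformation σ (Φ ω)
        (CompressedCRB.sensitivityMatrix x θ))) ∧
      Integrable (fun ω => CompressedCRB.crb (CompressedCRB.compressedFisherInformation σ (Φ ω)
        (CompressedCRB.sensitivityMatrix x θ)) i) μ ∧
      ∫ ω, CompressedCRB.crb (CompressedCRB.compressedFisherInformation σ (Φ ω)
        (CompressedCRB.sensitivityMatrix x θ)) i ∂μ =
        (((n : ℝ) - p) / ((m : ℝ) - p)) *
          CompressedCRB.crb
            (CompressedCRB.fisherInformation σ (CompressedCRB.sensitivityMatrix x θ)) i) ∧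
    (p + 1 < m →
      MemLp (fun ω => CompressedCRB.crb (CompressedCRB.compressedFisherInformation σ (Φ ω)
        (CompressedCRB.sensitivityMatrix x θ)) i) 2 μ ∧
      variance (fun ω => CompressedCRB.crb (CompressedCRB.compressedFisherInformation σ (Φ ω)
        (CompressedCRB.sensitivityMatrix x θ)) i) μ =
        (((n : ℝ) - m) * ((n : ℝ) - p) / (((m : ℝ) - p - 1) * ((m : ℝ) - p) ^ 2)) *
          (CompressedCRB.crb
            (CompressedCRB.fisherInformation σ (CompressedCRB.sensitivityMatrix x θ)) i) ^ 2) :=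
  mainTheorem7_general μ m n p (CompressedCRB.sensitivityMatrix x θ) σ hσ.ne' hJ Φ hΦ hΦ_rank i
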